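/- Let $G=(V,E,\omega)$ be a connected undirected graph with $n=|V|\ge 2$ nodes and positive integer edge weights, the weight of an edge being its length. Let $\omega(u,v)$ be the minimum total weight of a path from $u$ to $v$, let $D_\omega=\max_{u,v}\omega(u,v)$, and let $CC(u)=\frac{n-1}{\sum_{v\in V}\omega(u,v)}$ be the closeness centrality of $u$. The nodes communicate in synchronous rounds. In each round every node may send to each of its neighbours one message, of $O(\log n+\log D_\omega)$ bits if the node identifiers are at most $n^{O(1)}$ (so of $O(\log n)$ bits if, in addition, $D_\omega$ is polynomial in $n$). Initially a node knows only its own identifier, the identifiers of its neighbours and the weights of the edges to them, $n$, the smallest identifier in the network, and the input parameter $\varepsilon\in(0,1]$. For a constant $c>0$, Algorithm $\mathcal A_{CC}$ is the following. Every node joins a set $S$ independently with probability $\min\{1,\frac{c\log n}{n\varepsilon^2}\}$. The nodes then run a distributed $S$-shortest-paths algorithm, after which every node $u$ has halted and knows the distance $\omega(r,u)$ to every $r\in S$ (the nodes of $S$ being given by their identifiers). Finally, every node $u$ outputs $$\widehat{CC}(u)=1\Big/\sum_{r\in S}\frac{n\,\omega(r,u)}{|S|\,(n-1)} .$$ There is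 a distributed $S$-shortest-paths algorithm, the same for all networks, in the above model that for every network and every $S\subseteq V$ takes $O(|S|+D_\omega)$ rounds, and with it $\mathcal A_{CC}$ has the following property. For every $a>0$ there is a $c_0>0$ such that, for every constant $c\ge c_0$, every such network and every $\varepsilon\in(0,1]$, with probability at least $1-n^{-a}$: the set $S$ is non-empty and has $O(\log n/\varepsilon^2)$ elements, all nodes halt after $O\left(\frac{\log n}{\varepsilon^2}+D_\omega\right)$ rounds, and $$\left|\frac1{CC(u)}-\frac1{\widehat{CC}(u)}\right|\le \varepsilon D_\omega\qquad\text{for all }u\in V .$$ The constant in the bound $O(|S|+D_\omega)$ is absolute, the one in the message length depends only on the exponent in the bound on the identifiers, and the others depend only on $a$ and $c$. -/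

import Mathlib

/-- A connected network with positive integer edge weights (the lengths of the edges) and with
pairwise distinct node identifiers. Only the weights of the edges of `graph` matter. -/
structure Network (V : Type*) where
  graph : SimpleGraph V
  weight : Sym2 V → ℕ
  ident : V → ℕ
  connected : graph.Connected
  weight_pos : ∀ e ∈ graph.edgeSet, 0 < weight e
  ident_injective : Function.Injective ident

/-- What a node knows before the first round: the number of nodes, the smallest identifier in the
network, its own identifier, the identifiers of its neighbours paired with the weights of the
connecting edges, and whether it has joined the sample. -/
structure LocalView where
  numNodes : ℕ
  leader : ℕ
  self : ℕ
  nbrs : Finset (ℕ × ℕ)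
  sampled : Bool

/-- A synchronous message passing algorithm. All nodes run the same local program. In each round a
node may send to each neighbour (addressed by its identifier) one message, which is a natural number
written in binary; `none` means that nothing is sent. It then updates its state from the messages
received (indexed by the identifier of the sender). A node has halted once `output` is defined; the
output is a finite table of pairs (identifier, distance). -/
structure CongestAlgorithm where
  State : Type
  init : LocalView → State
  send : State → ℕ → Option ℕ
  receive : State → (ℕ → Option ℕ) → State
  output : State → Option (Finset (ℕ × ℕ))

namespace Network

variable {V : Type*}

/-- The weighted distance: the least total weight of a walk from `u` to `v`. -/
noncomputable def wdist (N : Network V) (u v : V) : ℕ :=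
  sInf {L : ℕ | ∃ p : N.graph.Walk u v, L = (p.edges.map N.weight).sum}

/-- The weighted eccentricity of `u`. -/
noncomputable def wecc [Fintype V] (N : Network V) (u : V) : ℕ :=
  Finset.univ.sup fun v => N.wdist u v

/-- The weighted diameter. -/
noncomputable def wdiam [Fintype V] (N : Network V) : ℕ :=
  Finset.univ.sup fun u => N.wecc u

/-- The closeness centrality of `u`. -/
noncomputable def closeness [Fintype V] (N : Network V) (u : V) : ℝ :=
  ((Fintype.card V : ℝ) - 1) / ∑ v : V, (N.wdist u v : ℝ)

open Classical in
/-- The initial knowledge of `v` when the nodes of `S` have joined the sample. -/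
noncomputable def view [Fintype V] (N : Network V) (S : Finset V) (v : V) : LocalView where
  numNodes := Fintype.card V
  leader := sInf (Set.range N.ident)
  self := N.ident v
  nbrs := (Finset.univ.filter fun u => N.graph.Adj v u).image
    fun u => (N.ident u, N.weight s(v, u))
  sampled := decide (v ∈ S)

/-- The table of the distances from `u` to all nodes of `S`. -/
noncomputable def distTable (N : Network V) (S : Finset V) (u : V) : Finset (ℕ × ℕ) :=
  S.image fun r => (N.ident r, N.wdist r u)

end Network

namespace CongestAlgorithm

variable {V : Type*}

open Classical in
/-- The message that `u` sends to `v` in a round that starts in configuration `σ`. Only neighbours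
can exchange messages, and a node that has halted sends nothing. -/
noncomputable def message (A : CongestAlgorithm) (N : Network V) (σ : V → A.State) (u v : V) :
    Option ℕ :=
  if N.graph.Adj u v ∧ A.output (σ u) = none then A.send (σ u) (N.ident v) else none

open Classical in
/-- One synchronous round. A node that has halted never changes its state again. -/
noncomputable def step (A : CongestAlgorithm) (N : Network V) (σ : V → A.State) : V → A.State :=
  fun v =>
    if A.output (σ v) = none then
      A.receive (σ v) fun i =>
        (Function.partialInv N.ident i).bind fun u => A.message N σ u v
    else σ v

/-- The configuration after `t` rounds, when the nodes of `S` have joined the sample. -/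
noncomputable def config [Fintype V] (A : CongestAlgorithm) (N : Network V) (S : Finset V)
    (t : ℕ) : V → A.State :=
  (A.step N)^[t] fun v => A.init (N.view S v)

end CongestAlgorithm

/-- The probability with which a node joins the sample. -/
noncomputable def joinProb (c : ℝ) (n : ℕ) (ε : ℝ) : ℝ :=
  min 1 (c * Real.log n / (n * ε ^ 2))

open Classical in
/-- The probability that a random subset of `V` has the property `E`, when each element of `V` is
put into the subset independently with probability `p`. -/
noncomputable def sampleProb {V : Type*} [Fintype V] (p : ℝ) (E : Finset V → Prop) : ℝ :=
  ∑ S : Finset V with E S, p ^ S.card * (1 - p) ^ (Fintype.card V - S.card)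

/-- The estimate of the closeness centrality that a node of a network with `n` nodes computes from
its table of distances to the sampled nodes. -/
noncomputable def ccEstimate (n : ℕ) (L : Finset (ℕ × ℕ)) : ℝ :=
  1 / ∑ x ∈ L, ((n : ℝ) * x.2) / (L.card * ((n : ℝ) - 1))

/-!
Every source sends its identifier through a pipeline. A node forwards the pair (source, distance)
in round `distance + rank`, where the rank is the number of sources before it in the order by
distance, ties being broken by identifier. No two pairs share a round, and since distances are
1-Lipschitz the rank of a source does not increase from a node to the next one on a shortest path
towards the source. By induction on the round, every node knows the correct distance by round
`distance + rank`, hence by round `D + |S|`.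

The nodes know neither `D` nor `|S|`, yet they must stop. The leader starts a wave of its own, and
a node that the wave has not reached by round `s` spreads the level `s`. A level `s` up to the
eccentricity `e` of the leader is heard everywhere by round `3 * s`, so a node that has heard of
no level above `s` by round `3 * (s + 1)` knows that `s = e`. All distances are at most `2 * e`,
and a node that misses a source knows at least as many sources as precede the first missing one;
so once `2 * e` plus the number of known sources has passed, none is missing. Thus all nodes halt
in round `3 * (e + 1) + |S|`.

The reciprocals of the centrality and of its estimate are `n / (n - 1)` times the averages of the
distances over `V` and over `S`. They are compared by a Chernoff bound, based on
`exp y ≤ 1 + y + y ^ 2`, for the sample sums of the constant `1` and of the distances to each node.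
-/

/-! ### Weighted distances -/

namespace Network

variable {V : Type*} (N : Network V)

theorem wdist_le {u v : V} (p : N.graph.Walk u v) :
    N.wdist u v ≤ (p.edges.map N.weight).sum :=
  Nat.sInf_le ⟨p, rfl⟩

theorem exists_walk_wdist (u v : V) :
    ∃ p : N.graph.Walk u v, N.wdist u v = (p.edges.map N.weight).sum := by
  obtain ⟨p⟩ := N.connected.preconnected u v
  exact Nat.sInf_mem (s := {L : ℕ | ∃ p : N.graph.Walk u v, L = (p.edges.map N.weight).sum})
    ⟨_, p, rfl⟩

@[simp]
theorem wdist_self (u : V) : N.wdist u u = 0 :=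
  Nat.le_zero.1 (N.wdist_le .nil)

theorem wdist_comm (u v : V) : N.wdist u v = N.wdist v u := by
  suffices h : ∀ u v, N.wdist u v ≤ N.wdist v u from le_antisymm (h u v) (h v u)
  intro u v
  obtain ⟨p, hp⟩ := N.exists_walk_wdist v u
  simpa [hp, List.sum_reverse] using N.wdist_le p.reverse

theorem wdist_triangle (u v w : V) : N.wdist u w ≤ N.wdist u v + N.wdist v w := by
  obtain ⟨p, hp⟩ := N.exists_walk_wdist u v
  obtain ⟨q, hq⟩ := N.exists_walk_wdist v w
  simpa [hp, hq] using N.wdist_le (p.append q)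

theorem wdist_le_weight {u v : V} (h : N.graph.Adj u v) : N.wdist u v ≤ N.weight s(u, v) := by
  simpa using N.wdist_le h.toWalk

theorem wdist_le_add_weight (r : V) {u v : V} (h : N.graph.Adj u v) :
    N.wdist r u ≤ N.wdist r v + N.weight s(u, v) := by
  rw [N.wdist_comm r u, N.wdist_comm r v, add_comm]
  exact (N.wdist_triangle u v r).trans (Nat.add_le_add_right (N.wdist_le_weight h) _)

theorem weight_pos_of_adj {u v : V} (h : N.graph.Adj u v) : 0 < N.weight s(u, v) :=
  N.weight_pos _ h

theorem exists_adj_wdist_add_weight {r u : V} (h : r ≠ u) :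
    ∃ v, N.graph.Adj u v ∧ N.wdist r v + N.weight s(u, v) = N.wdist r u := by
  obtain ⟨p, hp⟩ := N.exists_walk_wdist u r
  cases p with
  | nil => exact absurd rfl h
  | @cons _ v _ hadj q =>
    refine ⟨v, hadj, le_antisymm ?_ (N.wdist_le_add_weight r hadj)⟩
    have hq : N.wdist v r ≤ (q.edges.map N.weight).sum := N.wdist_le q
    rw [N.wdist_comm r v, N.wdist_comm r u, hp, SimpleGraph.Walk.edges_cons, List.map_cons,
      List.sum_cons]
    omega

theorem wdist_eq_zero_iff {u v : V} : N.wdist u v = 0 ↔ u = v := by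
  refine ⟨fun h => by_contra fun hne => ?_, fun h => h ▸ N.wdist_self u⟩
  obtain ⟨w, hw, hdist⟩ := N.exists_adj_wdist_add_weight hne
  have := N.weight_pos_of_adj hw
  omega

variable [Fintype V]

theorem wdist_le_wecc (u v : V) : N.wdist u v ≤ N.wecc u :=
  Finset.le_sup (f := fun v => N.wdist u v) (Finset.mem_univ v)

theorem wecc_le_wdiam (u : V) : N.wecc u ≤ N.wdiam :=
  Finset.le_sup (f := fun u => N.wecc u) (Finset.mem_univ u)

theorem wdist_le_wdiam (u v : V) : N.wdist u v ≤ N.wdiam :=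
  (N.wdist_le_wecc u v).trans (N.wecc_le_wdiam u)

theorem wdist_le_two_mul_wecc (l u v : V) : N.wdist u v ≤ 2 * N.wecc l := by
  have htri := N.wdist_triangle u l v
  have hu := N.wdist_le_wecc l u
  have hv := N.wdist_le_wecc l v
  rw [N.wdist_comm u l] at htri
  omega

theorem wdiam_pos [Nontrivial V] : 0 < N.wdiam := by
  obtain ⟨u, v, huv⟩ := exists_pair_ne V
  exact (Nat.pos_of_ne_zero (mt N.wdist_eq_zero_iff.1 huv)).trans_le (N.wdist_le_wdiam u v)

theorem exists_wdist_eq_wecc (u : V) : ∃ v, N.wdist u v = N.wecc u := by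
  obtain ⟨v, -, hv⟩ := Finset.exists_mem_eq_sup Finset.univ ⟨u, Finset.mem_univ u⟩ (N.wdist u)
  exact ⟨v, hv.symm⟩

theorem exists_adj_wdist_lt_le {l : V} {s : ℕ} (hs0 : 0 < s) (hs : s ≤ N.wecc l) :
    ∃ x y, N.graph.Adj x y ∧ N.wdist l y < s ∧ s ≤ N.wdist l x := by
  classical
  obtain ⟨z, hz⟩ := N.exists_wdist_eq_wecc l
  obtain ⟨x, hx, hmin⟩ := Finset.exists_min_image {x | s ≤ N.wdist l x} (N.wdist l)
    ⟨z, by simpa [hz] using hs⟩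
  simp only [Finset.mem_filter, Finset.mem_univ, true_and] at hx hmin
  have hlx : l ≠ x := fun h => by
    rw [← h, wdist_self] at hx
    omega
  obtain ⟨y, hxy, hdist⟩ := N.exists_adj_wdist_add_weight hlx
  refine ⟨x, y, hxy, not_le.1 fun hy => ?_, hx⟩
  have := hmin y hy
  have := N.weight_pos_of_adj hxy
  omega

end Network

/-! ### Runs without halting -/

namespace CongestAlgorithm

variable {V : Type*} [Fintype V] (A : CongestAlgorithm) (N : Network V) (S : Finset V)

open Classical in
/-- The messages that reach `v`, indexed by the identifier of the sender, when every node sends to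
all its neighbours, halted or not. -/
noncomputable def inbox (σ : V → A.State) (v : V) (i : ℕ) : Option ℕ :=
  (Function.partialInv N.ident i).bind fun u =>
    if N.graph.Adj v u then A.send (σ u) (N.ident v) else none

/-- A round in which halting is ignored. It is easier to analyse than `CongestAlgorithm.step` and
agrees with it as long as no node has halted. -/
noncomputable def freeStep (σ : V → A.State) : V → A.State := fun v =>
  A.receive (σ v) (A.inbox N σ v)

/-- The configuration after `t` rounds in which halting is ignored. -/
noncomputable def freeConfig (t : ℕ) : V → A.State :=
  (A.freeStep N)^[t] fun v => A.init (N.view S v)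

/-- All nodes halt together, after exactly `T` rounds. -/
def HaltsAt (T : ℕ) : Prop :=
  (∀ t < T, ∀ v, A.output (A.freeConfig N S t v) = none) ∧
    ∀ v, A.output (A.freeConfig N S T v) ≠ none

variable {A N S}

omit [Fintype V] in
theorem inbox_ident {σ : V → A.State} {u v : V} (h : N.graph.Adj v u) :
    A.inbox N σ v (N.ident u) = A.send (σ u) (N.ident v) := by
  rw [inbox, Function.partialInv_left N.ident_injective, Option.bind_some, if_pos h]

omit [Fintype V] in
theorem step_eq_freeStep {σ : V → A.State} (h : ∀ v, A.output (σ v) = none) :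
    A.step N σ = A.freeStep N σ := by
  classical
  funext v
  rw [step, if_pos (h v), freeStep]
  congr 1
  funext i
  simp only [inbox, message]
  congr 1
  exact funext fun u => if_congr (by rw [and_iff_left (h u), N.graph.adj_comm]) rfl rfl

omit [Fintype V] in
theorem step_eq_self {σ : V → A.State} (h : ∀ v, A.output (σ v) ≠ none) : A.step N σ = σ :=
  funext fun v => if_neg (h v)

theorem config_succ (t : ℕ) : A.config N S (t + 1) = A.step N (A.config N S t) :=
  Function.iterate_succ_apply' _ _ _

theorem freeConfig_succ (t : ℕ) : A.freeConfig N S (t + 1) = A.freeStep N (A.freeConfig N S t) :=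
  Function.iterate_succ_apply' _ _ _

namespace HaltsAt

variable {T t : ℕ}

theorem config_eq_freeConfig (h : A.HaltsAt N S T) (ht : t ≤ T) :
    A.config N S t = A.freeConfig N S t := by
  induction t with
  | zero => rfl
  | succ t ih => rw [config_succ, freeConfig_succ, ih (by omega), step_eq_freeStep (h.1 t ht)]

theorem config_eq_of_le (h : A.HaltsAt N S T) (ht : T ≤ t) :
    A.config N S t = A.freeConfig N S T := by
  induction t, ht using Nat.le_induction with
  | base => exact h.config_eq_freeConfig le_rfl
  | succ t _ ih => rw [config_succ, ih, step_eq_self h.2]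

theorem send_of_message (h : A.HaltsAt N S T) {u v : V} {m : ℕ}
    (hm : A.message N (A.config N S t) u v = some m) :
    t < T ∧ A.send (A.freeConfig N S t u) (N.ident v) = some m := by
  unfold message at hm
  split_ifs at hm with hsend
  have ht : t < T := not_le.1 fun hle => h.2 u (h.config_eq_of_le hle ▸ hsend.2)
  exact ⟨ht, h.config_eq_freeConfig ht.le ▸ hm⟩

end HaltsAt

end CongestAlgorithm

/-! ### Pipelined forwarding -/

/-- A finite set of pairs (identifier of a source, length of a walk from it), the knowledge that a
node has gathered about its distances to the sources. Superseded pairs are not removed. -/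
abbrev CandidateSet := Finset (ℕ × ℕ)

namespace CandidateSet

variable {K : CandidateSet} {x y : ℕ × ℕ} {t : ℕ}

/-- The order in which candidates are forwarded: by distance, ties being broken by identifier. -/
def key (x : ℕ × ℕ) : ℕ ×ₗ ℕ :=
  toLex x.swap

/-- The current distance estimates: the least candidate for each identifier. -/
def best (K : CandidateSet) : CandidateSet :=
  {x ∈ K | ∀ y ∈ K, y.1 = x.1 → x.2 ≤ y.2}

/-- The number of current estimates that are forwarded before `x`. -/
def rank (K : CandidateSet) (x : ℕ × ℕ) : ℕ :=
  {y ∈ K.best | key y < key x}.card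

open Classical in
/-- The estimate that is forwarded in round `t`, where `x` is scheduled for the round
`x.2 + K.rank x`. No two estimates share a round. -/
noncomputable def due (K : CandidateSet) (t : ℕ) : Option (ℕ × ℕ) :=
  if h : ∃ x ∈ K.best, x.2 + K.rank x = t then some h.choose else none

theorem key_injective : Function.Injective key :=
  toLex.injective.comp Prod.swap_injective

theorem snd_le_of_key_le (h : key x ≤ key y) : x.2 ≤ y.2 :=
  (Prod.Lex.toLex_le_toLex'.1 h).1

theorem key_lt_add {i j a b c w : ℕ} (h : key (i, a) < key (j, b)) (hc : c ≤ a + w) :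
    key (i, c) < key (j, b + w) := by
  simp only [key, Prod.swap_prod_mk, Prod.Lex.toLex_lt_toLex] at h ⊢
  omega

theorem best_subset : K.best ⊆ K :=
  Finset.filter_subset _ _

theorem rank_lt_rank (hx : x ∈ K.best) (h : key x < key y) : K.rank x < K.rank y := by
  refine Finset.card_lt_card (Finset.ssubset_iff_of_subset ?_ |>.2 ⟨x, ?_, ?_⟩)
  · exact Finset.monotone_filter_right _ fun z _ hz => hz.trans h
  · exact Finset.mem_filter.2 ⟨hx, h⟩
  · exact fun hmem => lt_irrefl _ (Finset.mem_filter.1 hmem).2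

theorem injOn_snd_add_rank : Set.InjOn (fun x => x.2 + K.rank x) K.best := by
  suffices h : ∀ x ∈ K.best, ∀ y, key x < key y → x.2 + K.rank x < y.2 + K.rank y by
    intro x hx y hy hxy
    rcases lt_trichotomy (key x) (key y) with hlt | heq | hlt
    · exact absurd hxy (h x hx y hlt).ne
    · exact key_injective heq
    · exact absurd hxy (h y hy x hlt).ne'
  exact fun x hx y hlt => add_lt_add_of_le_of_lt (snd_le_of_key_le hlt.le) (rank_lt_rank hx hlt)

theorem due_eq_some_iff : K.due t = some x ↔ x ∈ K.best ∧ x.2 + K.rank x = t := by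
  rw [due]
  split_ifs with h
  · obtain ⟨hmem, hround⟩ := h.choose_spec
    rw [Option.some_inj]
    exact ⟨fun hx => hx ▸ h.choose_spec,
      fun hx => injOn_snd_add_rank hmem hx.1 (hround.trans hx.2.symm)⟩
  · exact ⟨nofun, fun hx => absurd ⟨x, hx⟩ h⟩

end CandidateSet

namespace Network

open CandidateSet

variable {V : Type*} (N : Network V)

/-- The entry of the distance table of `u` for the source `r`. -/
noncomputable def distEntry (u r : V) : ℕ × ℕ :=
  (N.ident r, N.wdist r u)

theorem distEntry_injective (u : V) : Function.Injective (N.distEntry u) := fun _ _ h =>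
  N.ident_injective (congrArg Prod.fst h)

/-- The number of sources that precede `r` in the order of their distances to `u`. -/
noncomputable def sourceRank (S : Finset V) (u r : V) : ℕ :=
  {r' ∈ S | key (N.distEntry u r') < key (N.distEntry u r)}.card

variable {N} {S : Finset V} {u v r r' : V}

theorem sourceRank_mono (h : key (N.distEntry u r') ≤ key (N.distEntry u r)) :
    N.sourceRank S u r' ≤ N.sourceRank S u r :=
  Finset.card_le_card (Finset.monotone_filter_right _ fun _ _ hlt => hlt.trans_le h)

theorem sourceRank_lt_card (hr : r ∈ S) : N.sourceRank S u r < S.card :=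
  Finset.card_lt_card (Finset.filter_ssubset.2 ⟨r, hr, lt_irrefl _⟩)

theorem sourceRank_le_of_adj (huv : N.graph.Adj u v)
    (hdist : N.wdist r v + N.weight s(u, v) = N.wdist r u) :
    N.sourceRank S v r ≤ N.sourceRank S u r := by
  refine Finset.card_le_card (Finset.monotone_filter_right _ fun r' _ hlt => ?_)
  rw [distEntry, distEntry, ← hdist]
  exact key_lt_add hlt (N.wdist_le_add_weight r' huv)

variable [Fintype V]

open Classical in
variable (N S) in
/-- The candidates that `v` has gathered after `t` rounds of pipelined forwarding from the sources
in `S`: in each round every node forwards the candidate that is due to all its neighbours. -/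
noncomputable def candidates : ℕ → V → CandidateSet
  | 0, v => if v ∈ S then {(N.ident v, 0)} else ∅
  | t + 1, v => candidates t v ∪ {u | N.graph.Adj v u}.toFinset.biUnion fun u =>
      ((candidates t u).due t).toFinset.image fun x => (x.1, x.2 + N.weight s(v, u))

theorem mem_candidates_succ {t : ℕ} {x : ℕ × ℕ} :
    x ∈ N.candidates S (t + 1) v ↔ x ∈ N.candidates S t v ∨ ∃ u, N.graph.Adj v u ∧
      ∃ y, (N.candidates S t u).due t = some y ∧ (y.1, y.2 + N.weight s(v, u)) = x := by
  simp [candidates]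

theorem candidates_mono (v : V) : Monotone fun t => N.candidates S t v :=
  monotone_nat_of_le_succ fun _ _ hx => mem_candidates_succ.2 (Or.inl hx)

theorem exists_source_of_mem_candidates {t : ℕ} {x : ℕ × ℕ} (hx : x ∈ N.candidates S t u) :
    ∃ r ∈ S, N.ident r = x.1 ∧ N.wdist r u ≤ x.2 := by
  induction t generalizing u x with
  | zero =>
    rw [candidates] at hx
    split_ifs at hx with hu
    · rw [Finset.mem_singleton.1 hx]
      exact ⟨u, hu, rfl, (N.wdist_self u).le⟩
    · exact absurd hx (Finset.notMem_empty x)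
  | succ t ih =>
    rcases mem_candidates_succ.1 hx with hx | ⟨v, huv, y, hy, rfl⟩
    · exact ih hx
    · obtain ⟨r, hr, hid, hle⟩ := ih (best_subset (due_eq_some_iff.1 hy).1)
      exact ⟨r, hr, hid, (N.wdist_le_add_weight r huv).trans (Nat.add_le_add_right hle _)⟩

theorem distEntry_mem_best {t : ℕ} (h : N.distEntry u r ∈ N.candidates S t u) :
    N.distEntry u r ∈ (N.candidates S t u).best := by
  refine Finset.mem_filter.2 ⟨h, fun y hy hid => ?_⟩
  obtain ⟨r', -, hid', hle⟩ := exists_source_of_mem_candidates hy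
  obtain rfl := N.ident_injective (hid'.trans hid)
  exact hle

theorem eq_distEntry_of_mem_best {t : ℕ} {y : ℕ × ℕ} (hy : y ∈ (N.candidates S t u).best)
    (hid : N.ident r = y.1) (h : N.distEntry u r ∈ N.candidates S t u) :
    y = N.distEntry u r := by
  obtain ⟨hmem, hmin⟩ := Finset.mem_filter.1 hy
  obtain ⟨r', -, hid', hle⟩ := exists_source_of_mem_candidates hmem
  obtain rfl := N.ident_injective (hid'.trans hid.symm)
  exact Prod.ext hid.symm (le_antisymm (hmin _ h hid) hle)

theorem rank_distEntry {t : ℕ}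
    (h : ∀ r' ∈ S, key (N.distEntry u r') < key (N.distEntry u r) →
      N.distEntry u r' ∈ N.candidates S t u) :
    (N.candidates S t u).rank (N.distEntry u r) = N.sourceRank S u r := by
  rw [rank, sourceRank, ← Finset.card_image_of_injective _ (N.distEntry_injective u)]
  congr 1
  ext y
  simp only [Finset.mem_filter, Finset.mem_image]
  constructor
  · rintro ⟨hy, hlt⟩
    obtain ⟨r', hr', hid, hle⟩ := exists_source_of_mem_candidates (best_subset hy)
    have hlt' : key (N.distEntry u r') < key (N.distEntry u r) := by
      rw [distEntry, hid]
      exact key_lt_add (w := 0) hlt hle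
    exact ⟨r', ⟨hr', hlt'⟩, (eq_distEntry_of_mem_best hy hid (h r' hr' hlt')).symm⟩
  · rintro ⟨r', ⟨hr', hlt⟩, rfl⟩
    exact ⟨distEntry_mem_best (h r' hr' hlt), hlt⟩

theorem due_candidates {t : ℕ}
    (h : ∀ r' ∈ S, N.wdist r' v + N.sourceRank S v r' ≤ t →
      N.distEntry v r' ∈ N.candidates S t v)
    (hr : r ∈ S) (ht : N.wdist r v + N.sourceRank S v r = t) :
    (N.candidates S t v).due t = some (N.distEntry v r) := by
  refine due_eq_some_iff.2 ⟨distEntry_mem_best (h r hr ht.le), ?_⟩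
  rw [rank_distEntry fun r' hr' hlt => h r' hr' ?_]
  · exact ht
  · exact (add_le_add (snd_le_of_key_le hlt.le) (sourceRank_mono hlt.le)).trans ht.le

theorem distEntry_mem_candidates {t : ℕ} (hr : r ∈ S)
    (ht : N.wdist r u + N.sourceRank S u r ≤ t) : N.distEntry u r ∈ N.candidates S t u := by
  induction t using Nat.strong_induction_on generalizing u r with
  | _ t ih =>
    rcases eq_or_ne r u with rfl | hne
    · exact candidates_mono r t.zero_le (by simp [candidates, distEntry, hr])
    · obtain ⟨v, huv, hdist⟩ := N.exists_adj_wdist_add_weight hne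
      have hpos := N.weight_pos_of_adj huv
      have hrank := sourceRank_le_of_adj (S := S) huv hdist
      set t' := N.wdist r v + N.sourceRank S v r with ht'
      have hdue : (N.candidates S t' v).due t' = some (N.distEntry v r) :=
        due_candidates (fun r' hr' hle => ih t' (by omega) hr' hle) hr ht'.symm
      refine candidates_mono u (show t' + 1 ≤ t by omega) (mem_candidates_succ.2 (Or.inr ?_))
      exact ⟨v, huv, _, hdue, Prod.ext rfl hdist⟩

theorem best_candidates_eq_distTable {t : ℕ}
    (h : ∀ r ∈ S, N.distEntry u r ∈ N.candidates S t u) :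
    (N.candidates S t u).best = N.distTable S u := by
  ext y
  rw [distTable, Finset.mem_image]
  constructor
  · intro hy
    obtain ⟨r, hr, hid, -⟩ := exists_source_of_mem_candidates (best_subset hy)
    exact ⟨r, hr, (eq_distEntry_of_mem_best hy hid (h r hr)).symm⟩
  · rintro ⟨r, hr, rfl⟩
    exact distEntry_mem_best (h r hr)

variable (N S) in
/-- The identifiers of the sources that `u` knows after `t` rounds. -/
noncomputable def knownSources (t : ℕ) (u : V) : Finset ℕ :=
  (N.candidates S t u).image Prod.fst

theorem knownSources_subset (t : ℕ) (u : V) : N.knownSources S t u ⊆ S.image N.ident := by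
  intro i hi
  obtain ⟨x, hx, rfl⟩ := Finset.mem_image.1 hi
  obtain ⟨r, hr, hid, -⟩ := exists_source_of_mem_candidates hx
  exact Finset.mem_image.2 ⟨r, hr, hid⟩

theorem card_knownSources_le (t : ℕ) (u : V) : (N.knownSources S t u).card ≤ S.card :=
  (Finset.card_le_card (knownSources_subset t u)).trans Finset.card_image_le

/-- The first source that is unknown is preceded by known ones only, so its rank is at most their
number and it would have become known by time `t`. -/
theorem card_knownSources_eq {t D : ℕ} (hD : ∀ r, N.wdist r u ≤ D)
    (ht : D + (N.knownSources S t u).card ≤ t) : (N.knownSources S t u).card = S.card := by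
  suffices h : ∀ r ∈ S, N.ident r ∈ N.knownSources S t u by
    refine (card_knownSources_le t u).antisymm ?_
    rw [← Finset.card_image_of_injective S N.ident_injective]
    exact Finset.card_le_card (Finset.image_subset_iff.2 h)
  by_contra! hex
  obtain ⟨r, hr, hmin⟩ := Finset.exists_min_image {r ∈ S | N.ident r ∉ N.knownSources S t u}
    (fun r => key (N.distEntry u r)) (hex.imp fun _ h => Finset.mem_filter.2 h)
  obtain ⟨hrS, hunknown⟩ := Finset.mem_filter.1 hr
  have hrank : N.sourceRank S u r ≤ (N.knownSources S t u).card := by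
    rw [sourceRank, ← Finset.card_image_of_injective _ N.ident_injective]
    refine Finset.card_le_card (Finset.image_subset_iff.2 fun r' hr' => by_contra fun hr'' => ?_)
    obtain ⟨hr'S, hlt⟩ := Finset.mem_filter.1 hr'
    exact hlt.not_ge (hmin r' (Finset.mem_filter.2 ⟨hr'S, hr''⟩))
  exact hunknown (Finset.mem_image.2
    ⟨_, distEntry_mem_candidates hrS ((add_le_add (hD r) hrank).trans ht), rfl⟩)

end Network

/-! ### Termination -/

namespace Network

variable {V : Type*} (N : Network V) (l : V)

/-- The alarm level that `v` announces in round `t`, given its own level `a`: a node that the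
leader's wave has not reached yet knows that its distance to the leader is at least `t`. -/
noncomputable def raise (t : ℕ) (v : V) (a : ℕ) : ℕ :=
  if N.wdist l v < t then a else max a t

variable [Fintype V]

open Classical in
/-- The alarm level of `v` after `t` rounds: the greatest lower bound on the eccentricity of the
leader `l` that has reached `v`. -/
noncomputable def alarm : ℕ → V → ℕ
  | 0, _ => 0
  | t + 1, v => max (N.raise l t v (alarm t v))
      ({u | N.graph.Adj v u}.toFinset.sup fun u => N.raise l t u (alarm t u))

variable {N l} {s t : ℕ} {u v : V}

omit [Fintype V] in
theorem le_raise (a : ℕ) : a ≤ N.raise l t v a := by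
  unfold raise
  split_ifs <;> omega

omit [Fintype V] in
theorem le_raise_of_le_wdist (h : t ≤ N.wdist l v) (a : ℕ) : t ≤ N.raise l t v a := by
  rw [raise, if_neg h.not_gt]
  exact le_max_right a t

theorem raise_le_wecc {a : ℕ} (h : a ≤ N.wecc l) : N.raise l t v a ≤ N.wecc l := by
  unfold raise
  split_ifs with hv
  · exact h
  · exact max_le h ((not_lt.1 hv).trans (N.wdist_le_wecc l v))

theorem raise_le_alarm_succ : N.raise l t v (N.alarm l t v) ≤ N.alarm l (t + 1) v :=
  le_max_left _ _

theorem raise_le_alarm_succ_of_adj (h : N.graph.Adj v u) :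
    N.raise l t u (N.alarm l t u) ≤ N.alarm l (t + 1) v := by
  classical
  exact le_max_of_le_right
    (Finset.le_sup (f := fun u => N.raise l t u (N.alarm l t u)) (by simpa using h))

theorem alarm_le_wecc : N.alarm l t v ≤ N.wecc l := by
  induction t generalizing v with
  | zero => exact Nat.zero_le _
  | succ t ih => exact max_le (raise_le_wecc ih) (Finset.sup_le fun u _ => raise_le_wecc ih)

theorem alarm_mono (v : V) : Monotone fun t => N.alarm l t v :=
  monotone_nat_of_le_succ fun _ => (le_raise _).trans raise_le_alarm_succ

theorem alarm_le_alarm_add_wdist : N.alarm l t u ≤ N.alarm l (t + N.wdist u v) v := by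
  obtain ⟨p, hp⟩ := N.exists_walk_wdist u v
  rw [hp]
  clear hp
  induction p generalizing t with
  | nil => exact alarm_mono _ (Nat.le_add_right _ _)
  | @cons u w v h p ih =>
    rw [SimpleGraph.Walk.edges_cons, List.map_cons, List.sum_cons, ← add_assoc]
    calc N.alarm l t u ≤ N.alarm l (t + 1) w :=
          (le_raise _).trans (raise_le_alarm_succ_of_adj h.symm)
      _ ≤ N.alarm l (t + N.weight s(u, w)) w :=
          alarm_mono w (Nat.add_le_add_left (N.weight_pos_of_adj h) t)
      _ ≤ _ := ih

/-- An unreached node raises level `s` in round `s`. A node within distance `s` of the leader hears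
of it through the leader, along a detour of length less than `2 * s`. -/
theorem le_alarm (hs : s ≤ N.wecc l) (ht : 3 * s ≤ t) : s ≤ N.alarm l t u := by
  rcases s.eq_zero_or_pos with rfl | hs0
  · exact Nat.zero_le _
  rcases le_or_gt s (N.wdist l u) with hu | hu
  · exact (le_raise_of_le_wdist hu _).trans
      (raise_le_alarm_succ.trans (alarm_mono u (show s + 1 ≤ t by omega)))
  · obtain ⟨x, y, hxy, hy, hx⟩ := N.exists_adj_wdist_lt_le hs0 hs
    have hdist : N.wdist y l < s := N.wdist_comm l y ▸ hy
    calc s ≤ N.alarm l (s + 1) y :=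
          (le_raise_of_le_wdist hx _).trans (raise_le_alarm_succ_of_adj hxy.symm)
      _ ≤ N.alarm l (s + 1 + N.wdist y l) l := alarm_le_alarm_add_wdist
      _ ≤ N.alarm l (s + 1 + N.wdist y l + N.wdist l u) u := alarm_le_alarm_add_wdist
      _ ≤ N.alarm l t u := alarm_mono u (by omega)

theorem alarm_eq_wecc_of_wecc_le (ht : 3 * N.wecc l ≤ t) : N.alarm l t u = N.wecc l :=
  alarm_le_wecc.antisymm (le_alarm le_rfl ht)

theorem alarm_eq_wecc_of_alarm_succ_le (ht : 3 * (N.alarm l t u + 1) ≤ t) :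
    N.alarm l t u = N.wecc l := by
  by_contra hne
  exact (le_alarm (lt_of_le_of_ne alarm_le_wecc hne) ht).not_gt (Nat.lt_succ_self _)

theorem exists_lt_candidates_singleton_iff :
    (∃ x ∈ N.candidates {l} t v, x.2 < t) ↔ N.wdist l v < t := by
  constructor
  · rintro ⟨x, hx, hlt⟩
    obtain ⟨r, hr, -, hle⟩ := exists_source_of_mem_candidates hx
    exact Finset.mem_singleton.1 hr ▸ hle.trans_lt hlt
  · intro hlt
    have hrank : N.sourceRank {l} v l < 1 := sourceRank_lt_card (Finset.mem_singleton_self l)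
    exact ⟨N.distEntry v l, distEntry_mem_candidates (Finset.mem_singleton_self l) (by omega), hlt⟩

end Network

/-! ### The algorithm -/

namespace ShortestPaths

open CandidateSet

/-- The state of a node: its initial knowledge, the number of elapsed rounds, its candidates for
the distances to the leader and to the sampled nodes, and its alarm level. -/
structure State where
  view : LocalView
  time : ℕ
  leaderCands : CandidateSet
  sampleCands : CandidateSet
  alarm : ℕ

/-- A message: the candidate that is due in each of the two pipelines, and an alarm level. -/
abbrev Message := Option (ℕ × ℕ) × Option (ℕ × ℕ) × ℕ

/-- The message encoded by a number. Silence is read as a message without content. -/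
def decodeMessage (o : Option ℕ) : Message :=
  (o.bind Encodable.decode).getD (none, none, 0)

theorem decodeMessage_encode (m : Message) : decodeMessage (some (Encodable.encode m)) = m := by
  rw [decodeMessage, Option.bind_some, Encodable.encodek, Option.getD_some]

namespace State

/-- The candidate set with which a node enters a pipeline. -/
def start (i : ℕ) (isSource : Bool) : CandidateSet :=
  if isSource then {(i, 0)} else ∅

/-- The state before the first round. -/
def init (view : LocalView) : State where
  view := view
  time := 0
  leaderCands := start view.self (view.self = view.leader)
  sampleCands := start view.self view.sampled
  alarm := 0

/-- The message that a node sends to all its neighbours. -/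
noncomputable def outgoing (st : State) : Message :=
  (st.leaderCands.due st.time, st.sampleCands.due st.time,
    if ∃ x ∈ st.leaderCands, x.2 < st.time then st.alarm else max st.alarm st.time)

/-- The candidates in `K` together with the ones received from the neighbours, to which the weight
of the connecting edge has been added. -/
def extend (K : CandidateSet) (nbrs : Finset (ℕ × ℕ)) (received : ℕ → Option (ℕ × ℕ)) :
    CandidateSet :=
  K ∪ nbrs.biUnion fun e => (received e.1).toFinset.image fun x => (x.1, x.2 + e.2)

/-- The state after a round in which the messages `msg` have been received. -/
noncomputable def update (st : State) (msg : ℕ → Message) : State where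
  view := st.view
  time := st.time + 1
  leaderCands := extend st.leaderCands st.view.nbrs fun i => (msg i).1
  sampleCands := extend st.sampleCands st.view.nbrs fun i => (msg i).2.1
  alarm := max st.outgoing.2.2 (st.view.nbrs.sup fun e => (msg e.1).2.2)

/-- The test for termination. When it succeeds, the alarm level is the eccentricity of the leader
and all sources are known. -/
def Finished (st : State) : Prop :=
  3 * (st.alarm + 1) + (st.sampleCands.image Prod.fst).card ≤ st.time

end State

open State

open Classical in
/-- The algorithm for shortest paths from the sampled nodes: pipelined forwarding from the sampled
nodes and from the leader, together with the diffusion of the alarm levels. -/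
noncomputable def algorithm : CongestAlgorithm where
  State := State
  init := init
  send st _ := some (Encodable.encode st.outgoing)
  receive st inbox := st.update fun i => decodeMessage (inbox i)
  output st := if st.Finished then some st.sampleCands.best else none

variable {V : Type*} [Fintype V] (N : Network V) (S : Finset V) (l : V)

/-- The state of `v` after `t` rounds of the algorithm, if `l` is the leader. -/
noncomputable def stateAt (t : ℕ) (v : V) : State where
  view := N.view S v
  time := t
  leaderCands := N.candidates {l} t v
  sampleCands := N.candidates S t v
  alarm := N.alarm l t v

/-- The number of rounds after which all nodes halt, if `l` is the leader. -/
noncomputable def haltTime : ℕ :=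
  3 * (N.wecc l + 1) + S.card

variable {N S l} {t : ℕ} {u v : V}

theorem outgoing_stateAt : (stateAt N S l t v).outgoing =
    ((N.candidates {l} t v).due t, (N.candidates S t v).due t, N.raise l t v (N.alarm l t v)) := by
  simp only [outgoing, stateAt, Network.exists_lt_candidates_singleton_iff, Network.raise]

theorem init_view (hl : N.ident l = sInf (Set.range N.ident)) :
    init (N.view S v) = stateAt N S l 0 v := by
  classical
  have hleader : decide (N.ident v = sInf (Set.range N.ident)) = true ↔ v ∈ ({l} : Finset V) := by
    rw [decide_eq_true_iff, ← hl, N.ident_injective.eq_iff, Finset.mem_singleton]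
  simp only [init, stateAt, start, Network.view, Network.candidates, Network.alarm]
  congr 1
  · exact if_congr hleader rfl rfl
  · exact if_congr decide_eq_true_iff rfl rfl

theorem extend_candidates {msg : ℕ → Option (ℕ × ℕ)} (S' : Finset V)
    (hmsg : ∀ u, N.graph.Adj v u → msg (N.ident u) = (N.candidates S' t u).due t) :
    extend (N.candidates S' t v) (N.view S v).nbrs msg = N.candidates S' (t + 1) v := by
  ext x
  simp only [extend, Network.view, Network.mem_candidates_succ, Finset.mem_union,
    Finset.mem_biUnion, Finset.mem_image, Option.mem_toFinset, Option.mem_def, Finset.mem_filter,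
    Finset.mem_univ, true_and, exists_exists_and_eq_and]
  refine or_congr Iff.rfl (exists_congr fun u => and_congr_right fun hu => ?_)
  rw [hmsg u hu]

theorem update_stateAt {msg : ℕ → Message}
    (hmsg : ∀ u, N.graph.Adj v u → msg (N.ident u) = (stateAt N S l t u).outgoing) :
    (stateAt N S l t v).update msg = stateAt N S l (t + 1) v := by
  simp only [outgoing_stateAt] at hmsg
  have halarm : max (N.raise l t v (N.alarm l t v))
      ((N.view S v).nbrs.sup fun e => (msg e.1).2.2) = N.alarm l (t + 1) v := by
    rw [Network.alarm, Network.view, Finset.sup_image]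
    congr 1
    refine Finset.sup_congr (by ext; simp) fun u hu => ?_
    simp [hmsg u (by simpa using hu)]
  rw [update, outgoing_stateAt]
  simp only [stateAt]
  rw [extend_candidates {l} fun u hu => by rw [hmsg u hu],
    extend_candidates S fun u hu => by rw [hmsg u hu], halarm]

theorem freeConfig_algorithm (hl : N.ident l = sInf (Set.range N.ident)) :
    algorithm.freeConfig N S t = stateAt N S l t := by
  induction t with
  | zero => exact funext fun v => init_view hl
  | succ t ih =>
    rw [CongestAlgorithm.freeConfig_succ, ih]
    funext v
    refine update_stateAt fun u hu => ?_
    have hinbox := CongestAlgorithm.inbox_ident (A := algorithm) (σ := stateAt N S l t) hu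
    exact (congrArg decodeMessage hinbox).trans (decodeMessage_encode _)

theorem finished_stateAt_iff : (stateAt N S l t v).Finished ↔ haltTime N S l ≤ t := by
  change 3 * (N.alarm l t v + 1) + (N.knownSources S t v).card ≤ t ↔
    3 * (N.wecc l + 1) + S.card ≤ t
  constructor
  · intro ht
    rw [Network.alarm_eq_wecc_of_alarm_succ_le (by omega)] at ht
    have hD : ∀ r, N.wdist r v ≤ 2 * N.wecc l := fun r => N.wdist_le_two_mul_wecc l r v
    rwa [← Network.card_knownSources_eq (t := t) hD (by omega)]
  · intro ht
    rw [Network.alarm_eq_wecc_of_wecc_le (by omega)]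
    have := Network.card_knownSources_le (N := N) (S := S) t v
    omega

theorem haltsAt_algorithm (hl : N.ident l = sInf (Set.range N.ident)) :
    algorithm.HaltsAt N S (haltTime N S l) := by
  constructor
  · intro t ht v
    rw [freeConfig_algorithm hl]
    exact if_neg (mt finished_stateAt_iff.1 ht.not_ge)
  · intro v
    rw [freeConfig_algorithm hl]
    simp [algorithm, finished_stateAt_iff]

theorem output_config_algorithm (hl : N.ident l = sInf (Set.range N.ident)) :
    algorithm.output (algorithm.config N S (haltTime N S l) v) = some (N.distTable S v) := by
  rw [(haltsAt_algorithm hl).config_eq_freeConfig le_rfl, freeConfig_algorithm hl]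
  refine (if_pos (finished_stateAt_iff.2 le_rfl)).trans (congrArg some ?_)
  refine Network.best_candidates_eq_distTable fun r hr => Network.distEntry_mem_candidates hr ?_
  have hrank := Network.sourceRank_lt_card (N := N) (u := v) hr
  have hdist := N.wdist_le_two_mul_wecc l r v
  unfold haltTime
  omega

theorem haltTime_le [Nontrivial V] : haltTime N S l ≤ 6 * (S.card + N.wdiam) := by
  have hecc := N.wecc_le_wdiam l
  have hpos := N.wdiam_pos
  unfold haltTime
  omega

omit [Fintype V] in
theorem exists_leader (N : Network V) : ∃ l, N.ident l = sInf (Set.range N.ident) :=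
  have := N.connected.nonempty
  Nat.sInf_mem (Set.range_nonempty N.ident)

theorem exists_output_config_algorithm [Nontrivial V] (N : Network V) (S : Finset V) :
    ∃ T : ℕ, (T : ℝ) ≤ 6 * (S.card + N.wdiam) ∧
      ∀ v, algorithm.output (algorithm.config N S T v) = some (N.distTable S v) := by
  obtain ⟨l, hl⟩ := exists_leader N
  exact ⟨haltTime N S l, by exact_mod_cast haltTime_le, fun v => output_config_algorithm hl⟩

end ShortestPaths

/-! ### Message length -/

theorem pair_lt_sq {a b Y : ℕ} (ha : a < Y) (hb : b < Y) : Nat.pair a b < Y ^ 2 :=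
  (Nat.pair_lt_max_add_one_sq a b).trans_le (Nat.pow_le_pow_left (max_lt ha hb) 2)

theorem size_le_of_lt_pow {m k Y : ℕ} (h : m < Y ^ k) :
    (m.size : ℝ) ≤ k * (Real.log Y / Real.log 2 + 1) := by
  have hsize : m.size ≤ (Nat.log 2 Y + 1) * k := by
    rw [Nat.size_le, pow_mul]
    exact h.trans_le (Nat.pow_le_pow_left (Nat.lt_pow_succ_log_self one_lt_two Y).le k)
  calc (m.size : ℝ) ≤ k * (Nat.log 2 Y + 1) := by exact_mod_cast (mul_comm k _) ▸ hsize
    _ ≤ k * (Real.log Y / Real.log 2 + 1) := by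
      gcongr
      exact_mod_cast Real.natLog_le_logb Y 2

namespace ShortestPaths

open CandidateSet

theorem encode_option_lt {o : Option (ℕ × ℕ)} {Y : ℕ} (hY : 2 ≤ Y)
    (ho : ∀ x, o = some x → x.1 < Y ∧ x.2 < Y) : Encodable.encode o < Y ^ 3 := by
  cases o with
  | none => exact pow_pos (by omega) 3
  | some x =>
    obtain ⟨h₁, h₂⟩ := ho x rfl
    calc Encodable.encode (some x) = Nat.pair x.1 x.2 + 1 := rfl
      _ ≤ Y ^ 2 := pair_lt_sq h₁ h₂
      _ < Y ^ 3 := Nat.pow_lt_pow_right hY (by norm_num)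

theorem encode_message_lt {msg : Message} {Y : ℕ} (hY : 2 ≤ Y)
    (hleader : ∀ x, msg.1 = some x → x.1 < Y ∧ x.2 < Y)
    (hsample : ∀ x, msg.2.1 = some x → x.1 < Y ∧ x.2 < Y) (halarm : msg.2.2 < Y) :
    Encodable.encode msg < Y ^ 12 := by
  have halarm' : msg.2.2 < Y ^ 3 := halarm.trans_le (Nat.le_self_pow three_ne_zero Y)
  have htail := pair_lt_sq (encode_option_lt hY hsample) halarm'
  have hhead : Encodable.encode msg.1 < (Y ^ 3) ^ 2 :=
    (encode_option_lt hY hleader).trans_le (Nat.le_self_pow two_ne_zero _)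
  calc Encodable.encode msg
      = Nat.pair (Encodable.encode msg.1) (Nat.pair (Encodable.encode msg.2.1) msg.2.2) := rfl
    _ < ((Y ^ 3) ^ 2) ^ 2 := pair_lt_sq hhead htail
    _ = Y ^ 12 := by ring

variable {V : Type*} [Fintype V] {N : Network V} {S : Finset V} {κ t : ℕ} {u v : V}

theorem lt_of_due_candidates {Y : ℕ} {x : ℕ × ℕ} (hid : ∀ v, N.ident v < Y) (ht : t < Y)
    (hx : (N.candidates S t u).due t = some x) : x.1 < Y ∧ x.2 < Y := by
  obtain ⟨hmem, hround⟩ := due_eq_some_iff.1 hx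
  obtain ⟨r, -, hr, -⟩ := Network.exists_source_of_mem_candidates (best_subset hmem)
  exact ⟨hr ▸ hid r, by omega⟩

theorem message_lt_pow [Nontrivial V] {m Y : ℕ} (hid : ∀ v, N.ident v < Y)
    (hY : 6 * (Fintype.card V + N.wdiam) ≤ Y)
    (hm : algorithm.message N (algorithm.config N S t) u v = some m) : m < Y ^ 12 := by
  obtain ⟨l, hl⟩ := exists_leader N
  obtain ⟨ht, hsend⟩ := (haltsAt_algorithm hl).send_of_message hm
  rw [freeConfig_algorithm hl] at hsend
  have hcard : S.card ≤ Fintype.card V := S.card_le_univ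
  have hT := haltTime_le (N := N) (S := S) (l := l)
  have halarm : N.raise l t u (N.alarm l t u) < Y :=
    ((Network.raise_le_wecc Network.alarm_le_wecc).trans (N.wecc_le_wdiam l)).trans_lt (by omega)
  obtain rfl := Option.some_inj.1 hsend
  rw [outgoing_stateAt]
  exact encode_message_lt (by omega) (fun x hx => lt_of_due_candidates hid (by omega) hx)
    (fun x hx => lt_of_due_candidates hid (by omega) hx) halarm

theorem message_size_le [Nontrivial V] {m : ℕ} (hid : ∀ v, N.ident v ≤ Fintype.card V ^ κ)
    (hm : algorithm.message N (algorithm.config N S t) u v = some m) :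
    (m.size : ℝ) ≤ 12 * (κ + 6) / Real.log 2 *
      (Real.log (Fintype.card V) + Real.log N.wdiam) := by
  set n := Fintype.card V
  set D := N.wdiam
  have hn : 2 ≤ n := Fintype.one_lt_card
  have hD : 1 ≤ D := N.wdiam_pos
  have hY₁ : ∀ v, N.ident v < n ^ (κ + 5) * D := fun v =>
    calc N.ident v ≤ n ^ κ := hid v
      _ < n ^ (κ + 5) := Nat.pow_lt_pow_right hn (by omega)
      _ ≤ n ^ (κ + 5) * D := Nat.le_mul_of_pos_right _ hD
  have hY₂ : 6 * (n + D) ≤ n ^ (κ + 5) * D :=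
    calc 6 * (n + D) ≤ 2 ^ 4 * (n * D) := by nlinarith
      _ ≤ n ^ 4 * (n * D) := by gcongr
      _ = n ^ 5 * D := by ring
      _ ≤ n ^ (κ + 5) * D := by gcongr <;> omega
  have hlogn : Real.log 2 ≤ Real.log n := Real.log_le_log two_pos (by exact_mod_cast hn)
  have hlogD : 0 ≤ Real.log D := Real.log_natCast_nonneg D
  have hlogY : Real.log ((n ^ (κ + 5) * D : ℕ) : ℝ) = (κ + 5) * Real.log n + Real.log D := by
    push_cast
    rw [Real.log_mul (by positivity) (by positivity), Real.log_pow]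
    push_cast
    rfl
  calc (m.size : ℝ) ≤ 12 * (((κ + 5) * Real.log n + Real.log D) / Real.log 2 + 1) := by
        rw [← hlogY]
        exact_mod_cast size_le_of_lt_pow (message_lt_pow hY₁ hY₂ hm)
    _ = 12 * ((κ + 5) * Real.log n + Real.log D + Real.log 2) / Real.log 2 := by
        field_simp
    _ ≤ 12 * ((κ + 6) * (Real.log n + Real.log D)) / Real.log 2 := by
        gcongr
        nlinarith [mul_nonneg κ.cast_nonneg hlogD]
    _ = 12 * (κ + 6) / Real.log 2 * (Real.log n + Real.log D) := by ring

end ShortestPaths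

/-! ### Random samples -/

section Sampling

variable {V ι : Type*} [Fintype V] {p : ℝ}

/-- The expectation of `X S` for a random subset `S` of `V` into which each element is put
independently with probability `p`. -/
noncomputable def sampleExp (p : ℝ) : (Finset V → ℝ) →ₗ[ℝ] ℝ :=
  ∑ S : Finset V, (p ^ S.card * (1 - p) ^ (Fintype.card V - S.card)) • LinearMap.proj S

theorem sampleExp_apply (X : Finset V → ℝ) : sampleExp p X =
    ∑ S : Finset V, p ^ S.card * (1 - p) ^ (Fintype.card V - S.card) * X S := by
  simp [sampleExp]

theorem sampleProb_eq_sampleExp (E : Finset V → Prop) :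
    sampleProb p E = sampleExp p (Set.indicator {S | E S} 1) := by
  classical
  simp only [sampleProb, sampleExp_apply, Finset.sum_filter, Set.indicator_apply, Set.mem_ofPred_eq,
    Pi.one_apply, mul_ite, mul_one, mul_zero]

theorem sampleExp_prod (f : V → ℝ) :
    sampleExp p (fun S => ∏ r ∈ S, f r) = ∏ r, (p * f r + (1 - p)) := by
  classical
  rw [sampleExp_apply, Finset.prod_add, Finset.powerset_univ]
  refine Finset.sum_congr rfl fun S _ => ?_
  rw [Finset.prod_mul_distrib, Finset.prod_const, Finset.prod_const,
    Finset.card_sdiff_of_subset S.subset_univ, Finset.card_univ]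
  ring

theorem sampleExp_one : sampleExp p (1 : Finset V → ℝ) = 1 := by
  simpa [Pi.one_def] using sampleExp_prod (V := V) (p := p) 1

theorem sampleProb_one_of_univ {E : Finset V → Prop} (h : E Finset.univ) : sampleProb 1 E = 1 := by
  classical
  rw [sampleProb, Finset.sum_eq_single Finset.univ]
  · simp
  · intro S _ hS
    have hcard : S.card < Fintype.card V := (Finset.card_lt_iff_ne_univ S).2 hS
    simp [Nat.sub_ne_zero_of_lt hcard]
  · simp [h]

section

variable (hp0 : 0 ≤ p) (hp1 : p ≤ 1)
include hp0 hp1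

theorem sampleExp_mono {X Y : Finset V → ℝ} (h : X ≤ Y) : sampleExp p X ≤ sampleExp p Y := by
  rw [sampleExp_apply, sampleExp_apply]
  have := sub_nonneg.2 hp1
  gcongr with S
  exact h S

theorem sampleProb_mono {E F : Finset V → Prop} (h : ∀ S, E S → F S) :
    sampleProb p E ≤ sampleProb p F := by
  rw [sampleProb_eq_sampleExp, sampleProb_eq_sampleExp]
  exact sampleExp_mono hp0 hp1 (Set.indicator_le_indicator_of_subset h fun _ => zero_le_one)

theorem sampleProb_or_le (E F : Finset V → Prop) :
    sampleProb p (fun S => E S ∨ F S) ≤ sampleProb p E + sampleProb p F := by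
  classical
  simp only [sampleProb_eq_sampleExp, ← map_add]
  refine sampleExp_mono hp0 hp1 fun S => ?_
  by_cases hE : E S <;> by_cases hF : F S <;> simp [hE, hF]

theorem one_sub_sum_le_sampleProb_forall [Fintype ι] (E : ι → Finset V → Prop) :
    1 - ∑ i, sampleProb p (fun S => ¬E i S) ≤ sampleProb p fun S => ∀ i, E i S := by
  classical
  simp only [sampleProb_eq_sampleExp]
  rw [← sampleExp_one (V := V) (p := p), ← map_sum, ← map_sub]
  refine sampleExp_mono hp0 hp1 fun S => ?_
  simp only [Pi.sub_apply, Pi.one_apply, Finset.sum_apply, Set.indicator_apply, Set.mem_ofPred_eq]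
  split_ifs with h
  · exact sub_le_self _ (Finset.sum_nonneg fun i _ => by split_ifs <;> norm_num)
  · obtain ⟨i, hi⟩ := not_forall.1 h
    refine sub_nonpos.2 ?_
    calc (1 : ℝ) = if ¬E i S then 1 else 0 := (if_pos hi).symm
      _ ≤ _ := Finset.single_le_sum (f := fun i => if ¬E i S then (1 : ℝ) else 0)
        (fun i _ => by split_ifs <;> norm_num) (Finset.mem_univ i)

/-- Chernoff's method: the indicator of the event is at most `exp (∑ r ∈ S, y r - θ)`, whose
expectation is a product over `V`. -/
theorem sampleProb_le_sum_le_exp {y : V → ℝ} (hy : ∀ r, |y r| ≤ 1) (θ : ℝ) :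
    sampleProb p (fun S => θ ≤ ∑ r ∈ S, y r) ≤ Real.exp (p * ∑ r, (y r + y r ^ 2) - θ) := by
  have hfactor (r : V) : p * Real.exp (y r) + (1 - p) ≤ Real.exp (p * (y r + y r ^ 2)) := by
    have hquad := (abs_le.1 (Real.abs_exp_sub_one_sub_id_le (hy r))).2
    nlinarith [Real.add_one_le_exp (p * (y r + y r ^ 2)), mul_le_mul_of_nonneg_left hquad hp0]
  have hfactor_nonneg (r : V) : 0 ≤ p * Real.exp (y r) + (1 - p) :=
    add_nonneg (mul_nonneg hp0 (Real.exp_nonneg _)) (sub_nonneg.2 hp1)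
  calc sampleProb p (fun S => θ ≤ ∑ r ∈ S, y r)
      ≤ sampleExp p (Real.exp (-θ) • fun S => ∏ r ∈ S, Real.exp (y r)) := by
        rw [sampleProb_eq_sampleExp]
        refine sampleExp_mono hp0 hp1 (Set.indicator_le' (fun S hS => ?_) fun S _ => ?_)
        · rw [Pi.smul_apply, ← Real.exp_sum, smul_eq_mul, ← Real.exp_add]
          exact Real.one_le_exp (by simpa using hS)
        · exact mul_nonneg (Real.exp_nonneg _) (Finset.prod_nonneg fun r _ => Real.exp_nonneg _)
    _ = Real.exp (-θ) * ∏ r, (p * Real.exp (y r) + (1 - p)) := by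
        rw [map_smul, sampleExp_prod, smul_eq_mul]
    _ ≤ Real.exp (-θ) * ∏ r, Real.exp (p * (y r + y r ^ 2)) := by
        gcongr Real.exp (-θ) * ?_
        exact Finset.prod_le_prod (fun r _ => hfactor_nonneg r) fun r _ => hfactor r
    _ = Real.exp (p * ∑ r, (y r + y r ^ 2) - θ) := by
        rw [← Real.exp_sum, ← Real.exp_add, Finset.mul_sum]
        ring_nf

end

/-- The sum of `f` over the sample `S` deviates from its expectation by at most the fraction `δ` of
the expected sample size times the bound `B` on `f`. -/
def IsRepresentative (p δ B : ℝ) (f : V → ℝ) (S : Finset V) : Prop :=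
  |∑ r ∈ S, f r - p * ∑ r, f r| ≤ δ * (p * Fintype.card V) * B

variable {f : V → ℝ} {δ B : ℝ} {S : Finset V}

theorem isRepresentative_univ (hδ : 0 ≤ δ) (hB : 0 ≤ B) :
    IsRepresentative 1 δ B f Finset.univ := by
  rw [IsRepresentative, one_mul, sub_self, abs_zero]
  positivity

theorem sampleProb_add_le_sum_le (hp0 : 0 ≤ p) (hp1 : p ≤ 1) (hδ0 : 0 ≤ δ) (hδ2 : δ ≤ 2)
    (hB : 0 < B) (hf : ∀ r, |f r| ≤ B) :
    sampleProb p (fun S => p * ∑ r, f r + δ * (p * Fintype.card V) * B ≤ ∑ r ∈ S, f r) ≤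
      Real.exp (-(δ ^ 2 * (p * Fintype.card V) / 4)) := by
  -- the choice of `s` minimises the exponent `s ^ 2 * p * n * B ^ 2 - s * δ * p * n * B`
  set s := δ / (2 * B) with hs
  have hsB : s * B = δ / 2 := by
    rw [hs]
    field_simp
  have hs0 : 0 ≤ s := by positivity
  have hy (r : V) : |s * f r| ≤ δ / 2 := by
    rw [abs_mul, abs_of_nonneg hs0, ← hsB]
    exact mul_le_mul_of_nonneg_left (hf r) hs0
  have hsum : ∑ r, (s * f r + (s * f r) ^ 2) ≤ s * ∑ r, f r + Fintype.card V * (δ / 2) ^ 2 := by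
    rw [Finset.sum_add_distrib, ← Finset.mul_sum, ← nsmul_eq_mul, ← Finset.card_univ]
    gcongr
    exact Finset.sum_le_card_nsmul _ _ _ fun r _ => sq_le_sq.2 ((hy r).trans (le_abs_self _))
  set θ := p * ∑ r, f r + δ * (p * Fintype.card V) * B
  calc sampleProb p (fun S => θ ≤ ∑ r ∈ S, f r)
      ≤ sampleProb p (fun S => s * θ ≤ ∑ r ∈ S, s * f r) :=
        sampleProb_mono hp0 hp1 fun S hS => by
          rw [← Finset.mul_sum]
          exact mul_le_mul_of_nonneg_left hS hs0
    _ ≤ Real.exp (p * ∑ r, (s * f r + (s * f r) ^ 2) - s * θ) :=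
        sampleProb_le_sum_le_exp hp0 hp1 (fun r => (hy r).trans (by linarith)) _
    _ ≤ Real.exp (p * (s * ∑ r, f r + Fintype.card V * (δ / 2) ^ 2) - s * θ) := by gcongr
    _ = Real.exp (-(δ ^ 2 * (p * Fintype.card V) / 4)) := by
        congr 1
        linear_combination (-δ * p * Fintype.card V) * hsB

theorem sampleProb_not_isRepresentative_le (hp0 : 0 ≤ p) (hp1 : p ≤ 1) (hδ0 : 0 ≤ δ) (hδ2 : δ ≤ 2)
    (hB : 0 < B) (hf : ∀ r, |f r| ≤ B) :
    sampleProb p (fun S => ¬IsRepresentative p δ B f S) ≤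
      2 * Real.exp (-(δ ^ 2 * (p * Fintype.card V) / 4)) := by
  have hupper := sampleProb_add_le_sum_le hp0 hp1 hδ0 hδ2 hB hf
  have hlower := sampleProb_add_le_sum_le (f := -f) hp0 hp1 hδ0 hδ2 hB fun r => by simpa using hf r
  rw [two_mul]
  refine (sampleProb_mono hp0 hp1 fun S hS => ?_).trans
    ((sampleProb_or_le hp0 hp1 _ _).trans (add_le_add hupper hlower))
  simp only [Pi.neg_apply, Finset.sum_neg_distrib]
  rcases lt_abs.1 (not_le.1 hS) with h | h
  · exact Or.inl (by linarith)
  · exact Or.inr (by linarith)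

theorem one_sub_le_sampleProb_forall_isRepresentative [Fintype ι] {f : ι → V → ℝ} {B : ι → ℝ}
    (hp0 : 0 ≤ p) (hp1 : p ≤ 1) (hδ0 : 0 ≤ δ) (hδ2 : δ ≤ 2) (hB : ∀ i, 0 < B i)
    (hf : ∀ i r, |f i r| ≤ B i) :
    1 - 2 * Fintype.card ι * Real.exp (-(δ ^ 2 * (p * Fintype.card V) / 4)) ≤
      sampleProb p fun S => ∀ i, IsRepresentative p δ (B i) (f i) S := by
  refine le_trans ?_ (one_sub_sum_le_sampleProb_forall hp0 hp1 _)
  have hsum := Finset.sum_le_card_nsmul Finset.univ _ _ fun i _ =>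
    sampleProb_not_isRepresentative_le hp0 hp1 hδ0 hδ2 (hB i) (hf i)
  rw [nsmul_eq_mul, Finset.card_univ] at hsum
  linarith

namespace IsRepresentative

open Finset
open scoped BigOperators

variable (hone : IsRepresentative p δ 1 1 S)
include hone

theorem abs_card_sub_le : |(#S : ℝ) - p * Fintype.card V| ≤ δ * (p * Fintype.card V) := by
  simpa [IsRepresentative] using hone

theorem mul_card_le_two_mul_card (hδ : δ ≤ 1 / 2) : p * Fintype.card V ≤ 2 * #S := by
  have hlower := (abs_le.1 hone.abs_card_sub_le).1
  nlinarith [(#S).cast_nonneg (α := ℝ)]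

variable (hp : 0 < p) (hδ : δ ≤ 1 / 2)
include hp hδ

theorem card_le_two_mul : (#S : ℝ) ≤ 2 * (p * Fintype.card V) := by
  have hupper := (abs_le.1 hone.abs_card_sub_le).2
  nlinarith [mul_nonneg hp.le (Fintype.card V).cast_nonneg]

theorem nonempty [Nonempty V] : S.Nonempty := by
  have hcard : 0 < 2 * (#S : ℝ) :=
    (mul_pos hp (by exact_mod_cast Fintype.card_pos)).trans_le (hone.mul_card_le_two_mul_card hδ)
  exact card_pos.1 (by exact_mod_cast pos_of_mul_pos_right hcard two_pos.le)

theorem abs_expect_sub_expect_le [Nonempty V] (hS : IsRepresentative p δ B f S)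
    (hf : ∀ v, |f v| ≤ B) : |𝔼 v, f v - 𝔼 r ∈ S, f r| ≤ 4 * δ * B := by
  have hn : (0 : ℝ) < Fintype.card V := by exact_mod_cast Fintype.card_pos
  have hcard : (0 : ℝ) < #S := by
    exact_mod_cast (hone.nonempty hp hδ).card_pos
  have hδ0 : 0 ≤ δ :=
    nonneg_of_mul_nonneg_left ((abs_nonneg _).trans hone.abs_card_sub_le) (mul_pos hp hn)
  have hB : 0 ≤ B := (abs_nonneg _).trans (hf (Classical.arbitrary V))
  set m := 𝔼 v, f v with hm
  have hmB : |m| ≤ B := (abs_expect_le _ _).trans (expect_le univ_nonempty fun v _ => hf v)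
  have hsum : ∑ v, f v = Fintype.card V * m := by
    rw [hm, Fintype.expect_eq_sum_div_card, mul_div_cancel₀ _ hn.ne']
  have hdev : |#S * m - ∑ r ∈ S, f r| ≤ 2 * (δ * (p * Fintype.card V) * B) :=
    calc |#S * m - ∑ r ∈ S, f r|
        = |(#S - p * Fintype.card V) * m - (∑ r ∈ S, f r - p * ∑ v, f v)| := by
          rw [hsum]
          ring_nf
      _ ≤ |#S - p * Fintype.card V| * |m| + |∑ r ∈ S, f r - p * ∑ v, f v| := by
          rw [← abs_mul]
          exact abs_sub _ _
      _ ≤ δ * (p * Fintype.card V) * B + δ * (p * Fintype.card V) * B := by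
          gcongr
          · exact hone.abs_card_sub_le
          · exact hS
      _ = 2 * (δ * (p * Fintype.card V) * B) := (two_mul _).symm
  rw [expect_eq_sum_div_card, sub_div' hcard.ne', abs_div, abs_of_pos hcard, div_le_iff₀ hcard,
    mul_comm m]
  calc |#S * m - ∑ r ∈ S, f r| ≤ 2 * (δ * (p * Fintype.card V) * B) := hdev
    _ ≤ 2 * (δ * (2 * #S) * B) := by
        gcongr 2 * (δ * ?_ * B)
        exact hone.mul_card_le_two_mul_card hδ
    _ = 4 * δ * B * #S := by ring

end IsRepresentative

end Sampling

/-! ### Centrality estimates -/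

namespace Network

open scoped BigOperators

variable {V : Type*} [Fintype V] (N : Network V) {S : Finset V} {p ε : ℝ}

theorem one_div_closeness (u : V) : 1 / N.closeness u =
    Fintype.card V / ((Fintype.card V : ℝ) - 1) * 𝔼 v, (N.wdist v u : ℝ) := by
  have hn : (Fintype.card V : ℝ) ≠ 0 := by exact_mod_cast (Fintype.card_pos_iff.2 ⟨u⟩).ne'
  rw [closeness, one_div_div, Fintype.expect_eq_sum_div_card, div_mul_div_comm,
    mul_comm ((Fintype.card V : ℝ) - 1), mul_div_mul_left _ _ hn]
  simp only [N.wdist_comm u]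

omit [Fintype V] in
theorem one_div_ccEstimate (S : Finset V) (n : ℕ) (u : V) :
    1 / ccEstimate n (N.distTable S u) =
      n / ((n : ℝ) - 1) * 𝔼 r ∈ S, (N.wdist r u : ℝ) := by
  have htable : N.distTable S u = S.image (N.distEntry u) := rfl
  have hinj := N.distEntry_injective u
  rw [ccEstimate, one_div_one_div, htable, Finset.card_image_of_injective S hinj,
    Finset.sum_image hinj.injOn, ← Finset.sum_div, ← Finset.mul_sum,
    Finset.expect_eq_sum_div_card, div_mul_div_comm, mul_comm ((n : ℝ) - 1)]
  simp only [distEntry]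

/-- A sample that is representative for its own size and for the distances to every node. The
tolerance `ε / 8` keeps the error of the estimated centralities below `ε * N.wdiam`. -/
def IsGoodSample (p ε : ℝ) (S : Finset V) : Prop :=
  IsRepresentative p (ε / 8) 1 1 S ∧
    ∀ u, IsRepresentative p (ε / 8) N.wdiam (fun v => (N.wdist v u : ℝ)) S

theorem abs_wdist_le_wdiam (u v : V) : |(N.wdist v u : ℝ)| ≤ N.wdiam := by
  rw [Nat.abs_cast]
  exact_mod_cast N.wdist_le_wdiam v u

variable {N}

theorem isGoodSample_univ (hε : 0 ≤ ε) : N.IsGoodSample 1 ε Finset.univ :=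
  ⟨isRepresentative_univ (by positivity) zero_le_one,
    fun _ => isRepresentative_univ (by positivity) (Nat.cast_nonneg _)⟩

theorem IsGoodSample.abs_one_div_sub_one_div_le [Nontrivial V] (hS : N.IsGoodSample p ε S)
    (hp : 0 < p) (hε : ε ≤ 4) (u : V) :
    |1 / N.closeness u - 1 / ccEstimate (Fintype.card V) (N.distTable S u)| ≤ ε * N.wdiam := by
  have hn : (2 : ℝ) ≤ Fintype.card V := by exact_mod_cast Fintype.one_lt_card
  have hscale0 : (0 : ℝ) ≤ Fintype.card V / ((Fintype.card V : ℝ) - 1) :=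
    div_nonneg (by linarith) (by linarith)
  have hscale : (Fintype.card V : ℝ) / ((Fintype.card V : ℝ) - 1) ≤ 2 :=
    (div_le_iff₀ (by linarith)).2 (by linarith)
  rw [one_div_closeness, one_div_ccEstimate, ← mul_sub, abs_mul, abs_of_nonneg hscale0]
  calc _ ≤ 2 * (4 * (ε / 8) * N.wdiam) := by
        gcongr
        exact hS.1.abs_expect_sub_expect_le hp (by linarith) (hS.2 u) (N.abs_wdist_le_wdiam u)
    _ = ε * N.wdiam := by ring

theorem one_sub_le_sampleProb_isGoodSample [Nontrivial V] (hp0 : 0 ≤ p) (hp1 : p ≤ 1)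
    (hε0 : 0 ≤ ε) (hε : ε ≤ 16) :
    1 - 2 * (Fintype.card V + 1) * Real.exp (-(ε ^ 2 * (p * Fintype.card V) / 256)) ≤
      sampleProb p (N.IsGoodSample p ε) := by
  let f : Option V → V → ℝ := fun o v => o.elim 1 fun u => N.wdist v u
  let B : Option V → ℝ := fun o => o.elim 1 fun _ => N.wdiam
  have hB : ∀ o, 0 < B o
    | none => one_pos
    | some _ => Nat.cast_pos.2 N.wdiam_pos
  have hf : ∀ o v, |f o v| ≤ B o
    | none, _ => abs_one.le
    | some u, v => N.abs_wdist_le_wdiam u v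
  have hprob := one_sub_le_sampleProb_forall_isRepresentative hp0 hp1
    (by positivity : 0 ≤ ε / 8) (by linarith) hB hf
  have hexp : (ε / 8) ^ 2 * (p * Fintype.card V) / 4 = ε ^ 2 * (p * Fintype.card V) / 256 := by ring
  rw [Fintype.card_option, Nat.cast_add_one, hexp] at hprob
  exact hprob.trans (sampleProb_mono hp0 hp1 fun S hS => ⟨hS none, fun u => hS (some u)⟩)

end Network

section JoinProb

variable {c ε a : ℝ} {n : ℕ}

theorem joinProb_le_one : joinProb c n ε ≤ 1 :=
  min_le_left _ _

theorem joinProb_pos (hc : 0 < c) (hn : 2 ≤ n) (hε : 0 < ε) : 0 < joinProb c n ε := by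
  have hlog : 0 < Real.log n := Real.log_pos (by exact_mod_cast hn)
  exact lt_min one_pos (by positivity)

theorem joinProb_mul_le (hn : 0 < n) : joinProb c n ε * n ≤ c * (Real.log n / ε ^ 2) := by
  have hn0 : (n : ℝ) ≠ 0 := by exact_mod_cast hn.ne'
  calc joinProb c n ε * n ≤ c * Real.log n / (n * ε ^ 2) * n := by
        gcongr
        exact min_le_right _ _
    _ = c * (Real.log n / ε ^ 2) := by
        rw [div_mul_eq_mul_div, mul_comm, mul_div_mul_left _ _ hn0, mul_div_assoc]

theorem joinProb_eq_one_or (hn : 0 < n) (hε : 0 < ε) :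
    joinProb c n ε = 1 ∨ ε ^ 2 * (joinProb c n ε * n) = c * Real.log n := by
  refine (min_choice 1 (c * Real.log n / (n * ε ^ 2))).imp id fun h => ?_
  rw [joinProb, h]
  field_simp

theorem two_mul_succ_mul_exp_le_rpow_neg (hn : 2 ≤ n) (hc : a + 3 ≤ c) :
    2 * ((n : ℝ) + 1) * Real.exp (-(c * Real.log n)) ≤ (n : ℝ) ^ (-a) := by
  have hn2 : (2 : ℝ) ≤ n := by exact_mod_cast hn
  have hcube : 2 * ((n : ℝ) + 1) ≤ (n : ℝ) ^ (3 : ℝ) := by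
    rw [Real.rpow_ofNat]
    nlinarith [mul_le_mul hn2 hn2 two_pos.le (by linarith)]
  calc 2 * ((n : ℝ) + 1) * Real.exp (-(c * Real.log n))
      = 2 * ((n : ℝ) + 1) * (n : ℝ) ^ (-c) := by
        rw [Real.rpow_def_of_pos (by linarith)]
        ring_nf
    _ ≤ (n : ℝ) ^ (3 : ℝ) * (n : ℝ) ^ (-(a + 3)) := by
        gcongr
        linarith
    _ = (n : ℝ) ^ (-a) := by
        rw [← Real.rpow_add (by linarith)]
        ring_nf

end JoinProb

namespace Network

variable {V : Type*} [Fintype V] [Nontrivial V] {N : Network V} {S : Finset V} {ε c a : ℝ}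

theorem one_sub_rpow_le_sampleProb_isGoodSample (ha : 0 < a) (hc : 256 * (a + 3) ≤ c) (hε0 : 0 < ε)
    (hε : ε ≤ 16) : 1 - (Fintype.card V : ℝ) ^ (-a) ≤
      sampleProb (joinProb c (Fintype.card V) ε)
        (N.IsGoodSample (joinProb c (Fintype.card V) ε) ε) := by
  set n := Fintype.card V
  have hn : 2 ≤ n := Fintype.one_lt_card
  rcases joinProb_eq_one_or (c := c) (by omega : 0 < n) hε0 with hp | hp
  · rw [hp, sampleProb_one_of_univ (isGoodSample_univ (by positivity))]
    exact sub_le_self _ (by positivity)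
  · refine le_trans ?_ (one_sub_le_sampleProb_isGoodSample
      (joinProb_pos (by linarith) hn hε0).le joinProb_le_one hε0.le hε)
    have htail := two_mul_succ_mul_exp_le_rpow_neg (c := c / 256) hn (by linarith : a + 3 ≤ c / 256)
    rw [hp, ← div_mul_eq_mul_div]
    linarith

theorem IsGoodSample.card_le (hc : 0 < c) (hε0 : 0 < ε) (hε : ε ≤ 4)
    (hS : N.IsGoodSample (joinProb c (Fintype.card V) ε) ε S) :
    (S.card : ℝ) ≤ 2 * (c * (Real.log (Fintype.card V) / ε ^ 2)) :=
  (hS.1.card_le_two_mul (joinProb_pos hc Fintype.one_lt_card hε0) (by linarith)).trans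
    (mul_le_mul_of_nonneg_left (joinProb_mul_le Fintype.card_pos) two_pos.le)

end Network

theorem theorem4 :
    ∃ (A : CongestAlgorithm) (C₀ : ℝ),
      -- for every sample, all nodes halt knowing exactly their distances to the sampled nodes
      (∀ (V : Type) [Fintype V] (N : Network V) (S : Finset V), 2 ≤ Fintype.card V →
        ∃ T : ℕ, (T : ℝ) ≤ C₀ * (S.card + N.wdiam) ∧
          ∀ u : V, A.output (A.config N S T u) = some (N.distTable S u)) ∧
      -- all messages are short
      (∀ κ : ℕ, ∃ B : ℝ, ∀ (V : Type) [Fintype V] (N : Network V) (S : Finset V),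
        2 ≤ Fintype.card V → (∀ v, N.ident v ≤ Fintype.card V ^ κ) →
        ∀ (t : ℕ) (u v : V) (m : ℕ), A.message N (A.config N S t) u v = some m →
          (m.size : ℝ) ≤ B * (Real.log (Fintype.card V) + Real.log N.wdiam)) ∧
      -- sample size, running time and approximation error, with high probability
      (∀ a : ℝ, 0 < a → ∃ c₀ : ℝ, 0 < c₀ ∧ ∀ c : ℝ, c₀ ≤ c → ∃ C : ℝ,
        ∀ (V : Type) [Fintype V] (N : Network V) (ε : ℝ),
          2 ≤ Fintype.card V → 0 < ε → ε ≤ 1 →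
          1 - (Fintype.card V : ℝ) ^ (-a) ≤
            sampleProb (joinProb c (Fintype.card V) ε) fun S : Finset V =>
              S.Nonempty ∧
              (S.card : ℝ) ≤ C * (Real.log (Fintype.card V) / ε ^ 2) ∧
              ∃ T : ℕ,
                (T : ℝ) ≤ C * (Real.log (Fintype.card V) / ε ^ 2 + N.wdiam) ∧
                ∀ u : V, ∃ L : Finset (ℕ × ℕ),
                  A.output (A.config N S T u) = some L ∧
                  |1 / N.closeness u - 1 / ccEstimate (Fintype.card V) L| ≤ ε * N.wdiam) := by
  refine ⟨ShortestPaths.algorithm, 6, fun V _ N S hn => ?_,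
    fun κ => ⟨12 * (κ + 6) / Real.log 2, fun V _ N S hn hid t u v m hm => ?_⟩,
    fun a ha => ⟨256 * (a + 3), by positivity, fun c hc => ⟨12 * c + 6, ?_⟩⟩⟩
  · have := Fintype.one_lt_card_iff_nontrivial.1 hn
    exact ShortestPaths.exists_output_config_algorithm N S
  · have := Fintype.one_lt_card_iff_nontrivial.1 hn
    exact ShortestPaths.message_size_le hid hm
  · intro V _ N ε hn hε0 hε1
    have := Fintype.one_lt_card_iff_nontrivial.1 hn
    have hc0 : 0 < c := by linarith
    refine (Network.one_sub_rpow_le_sampleProb_isGoodSample (N := N) ha hc hε0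
      (by linarith)).trans
      (sampleProb_mono (joinProb_pos hc0 hn hε0).le joinProb_le_one fun S hS => ?_)
    have hp := joinProb_pos hc0 hn hε0
    have hcard := hS.card_le hc0 hε0 (by linarith)
    have hM : 0 ≤ Real.log (Fintype.card V) / ε ^ 2 := by positivity
    obtain ⟨T, hT, hout⟩ := ShortestPaths.exists_output_config_algorithm N S
    refine ⟨hS.1.nonempty hp (by linarith), by nlinarith, T, ?_, fun u =>
      ⟨_, hout u, hS.abs_one_div_sub_one_div_le hp (by linarith) u⟩⟩
    nlinarith [mul_nonneg hc0.le N.wdiam.cast_nonneg]
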